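/- Let $k\in\mathbb{N}$ and let $\lambda_1,\dots,\lambda_k\ge 0$ and $\mu_1,\dots,\mu_k\ge 0$ be real numbers; put $\Lambda=\sum_{j=1}^k\lambda_j$ and $T=\sum_{j=1}^k\mu_j$. A *counting process* is a process $\{N(t)\}_{t\ge 0}$ with values in $\{0,1,2,\dots\}$ whose paths are almost surely nondecreasing. A *Poisson process with rate* $r$ is a counting process with independent and stationary increments such that $N(t)$ is Poisson distributed with parameter $rt$ for all $t\ge 0$. A *generalized counting process* (GCP) with intensity parameters $\lambda_1,\dots,\lambda_k$ is a counting process $\{M(t)\}_{t\ge 0}$ with $M(0)=0$ almost surely and with independent and stationary increments, such that, as $h\downarrow 0$, $P(M(h)=j)=\lambda_j h+o(h)$ for $1\le j\le k$ and $P(M(h)>k)=o(h)$. A *generalized Skellam process* (GSP) with parameters $\lambda_1,\dots,\lambda_k$ and $\mu_1,\dots,\mu_k$ is $S(t)=M_1(t)-M_2(t)$, where $M_1$ and $M_2$ are independent GCPs with intensity parameters $\lambda_1,\dots,\lambda_k$ and $\mu_1,\dots,\mu_k$, respectively. The *running average* of a process $X$ is $X_A(t)=\frac1t\int_0^tX(s)\,ds$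 for $t>0$, and $X_A(0)=0$. **(1) GSP.** Let $S$ be a GSP with these parameters. For every $t\ge 0$ the paths of $S$ are almost surely integrable on $[0,t]$, $S_A(t)$ is a random variable, and its characteristic function is $\phi_{S_A(t)}(0)=1$ and, for real $u\neq 0$, $$\phi_{S_A(t)}(u)=\exp\left(t\left\{\sum_{j=1}^{k}\lambda_j\left(\frac{e^{iuj}-1}{iuj}-1\right)+\sum_{j=1}^{k}\mu_j\left(\frac{1-e^{-iuj}}{iuj}-1\right)\right\}\right).$$ Suppose moreover that $\Lambda+T>0$. Let $Y(t)=\sum_{i=1}^{N(t)}X_i$, where $\{N(t)\}_{t\ge0}$ is a Poisson process with rate $\Lambda+T$ and $X_1,X_2,\dots$ are i.i.d. random variables, independent of $\{N(t)\}_{t\ge 0}$, with the mixed double uniform density $$f(x)=\frac{1}{\Lambda+T}\sum_{j=1}^{k}\frac{\lambda_j}{j}\mathbf 1_{[0,j]}(x)+\frac{1}{\Lambda+T}\sum_{j=1}^{k}\frac{\mu_j}{j}\mathbf 1_{[-j,0]}(x).$$ Then, for every $t\ge 0$, $Y(t)\overset{d}{=}S_A(t)$. **(2) GCP.** Let $M$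 be a GCP with intensity parameters $\lambda_1,\dots,\lambda_k$. For every $t\ge 0$ the paths of $M$ are almost surely integrable on $[0,t]$, $M_A(t)$ is a random variable, and its characteristic function is $\phi_{M_A(t)}(0)=1$ and, for real $u\ne 0$, $$\phi_{M_A(t)}(u)=\exp\left(t\sum_{j=1}^{k}\lambda_j\left(\frac{e^{iuj}-1}{iuj}-1\right)\right).$$ If moreover $\Lambda>0$, then for every $t\ge 0$ $$M_A(t)\overset{d}{=}\sum_{i=1}^{N(t)}X_i,$$ where $\{N(t)\}_{t\ge 0}$ is a Poisson process with rate $\Lambda$ and $X_1,X_2,\dots$ are i.i.d. random variables, independent of $\{N(t)\}_{t\ge 0}$, with density $f(x)=\sum_{j=1}^{k}\frac{\lambda_j}{\Lambda}\cdot\frac1j\mathbf 1_{[0,j]}(x)$. -/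

import Mathlib

open MeasureTheory ProbabilityTheory Filter Topology Asymptotics
open scoped NNReal

noncomputable section

/-- `X (s + h) - X s` has the same law as `X h - X 0`, for all times `s`, `h`. -/
def HasStationaryIncrements {Ω : Type*} [MeasurableSpace Ω] (X : ℝ≥0 → Ω → ℝ)
    (P : Measure Ω) : Prop :=
  ∀ s h : ℝ≥0, IdentDistrib (fun ω => X (s + h) ω - X s ω) (fun ω => X h ω - X 0 ω) P P

/-- A counting process: a family of `ℕ`-valued random variables with almost surely
nondecreasing paths. -/
structure IsCountingProcess {Ω : Type*} [MeasurableSpace Ω] (N : ℝ≥0 → Ω → ℕ)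
    (P : Measure Ω) : Prop where
  measurable : ∀ t, Measurable (N t)
  mono : ∀ᵐ ω ∂P, Monotone (fun t => N t ω)

/-- A counting process with independent and stationary increments. -/
structure IsStationaryIndepCountingProcess {Ω : Type*} [MeasurableSpace Ω] (N : ℝ≥0 → Ω → ℕ)
    (P : Measure Ω) : Prop extends IsCountingProcess N P where
  indep_increments : HasIndepIncrements (fun t ω => (N t ω : ℝ)) P
  stationary_increments : HasStationaryIncrements (fun t ω => (N t ω : ℝ)) P

/-- A Poisson process of rate `r`. -/
structure IsPoissonProcess {Ω : Type*} [MeasurableSpace Ω] (r : ℝ≥0) (N : ℝ≥0 → Ω → ℕ)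
    (P : Measure Ω) : Prop extends IsStationaryIndepCountingProcess N P where
  law : ∀ t, P.map (N t) = poissonMeasure (r * t)

/-- A generalized counting process (GCP): it starts at `0`, has independent and stationary
increments, and during a short time `h` jumps by `j` with probability `lam j * h + o(h)`
for `1 ≤ j ≤ k`, and by more than `k` with probability `o(h)`. Only the values
`lam 1, …, lam k` are used. -/
structure IsGCP {Ω : Type*} [MeasurableSpace Ω] (k : ℕ) (lam : ℕ → ℝ≥0) (M : ℝ≥0 → Ω → ℕ)
    (P : Measure Ω) : Prop extends IsStationaryIndepCountingProcess M P where
  zero : ∀ᵐ ω ∂P, M 0 ω = 0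
  prob_jump : ∀ j ∈ Finset.Icc 1 k,
    (fun h : ℝ≥0 => P.real {ω | M h ω = j} - (lam j : ℝ) * (h : ℝ))
      =o[𝓝[>] (0 : ℝ≥0)] (fun h : ℝ≥0 => (h : ℝ))
  prob_large : (fun h : ℝ≥0 => P.real {ω | k < M h ω})
      =o[𝓝[>] (0 : ℝ≥0)] (fun h : ℝ≥0 => (h : ℝ))

/-- A generalized Skellam process (GSP): the difference of two independent GCPs. -/
def IsGSP {Ω : Type*} [MeasurableSpace Ω] (k : ℕ) (lam mu : ℕ → ℝ≥0) (S : ℝ≥0 → Ω → ℤ)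
    (P : Measure Ω) : Prop :=
  ∃ M₁ M₂ : ℝ≥0 → Ω → ℕ, IsGCP k lam M₁ P ∧ IsGCP k mu M₂ P ∧
    IndepFun (fun ω t => M₁ t ω) (fun ω t => M₂ t ω) P ∧
    ∀ t ω, S t ω = (M₁ t ω : ℤ) - (M₂ t ω : ℤ)

/-- The running average `(1/t) ∫₀ᵗ X(s) ds`; at `t = 0` its value is `0`. -/
def runningAverage {Ω : Type*} (X : ℝ≥0 → Ω → ℝ) (t : ℝ≥0) (ω : Ω) : ℝ :=
  (1 / (t : ℝ)) * ∫ s in (0 : ℝ)..(t : ℝ), X s.toNNReal ω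

/-- The total rate `lam 1 + ⋯ + lam k`. -/
def totalRate (k : ℕ) (lam : ℕ → ℝ≥0) : ℝ≥0 := ∑ j ∈ Finset.Icc 1 k, lam j

/-- The density of the uniform distribution on `[a, b]`. -/
def uniformDensity (a b : ℝ) (x : ℝ) : ℝ := (Set.Icc a b).indicator (fun _ => 1 / (b - a)) x

/-- The density of the mixture of the uniform distributions on `[0, j]`, `1 ≤ j ≤ k`, with
weights `lam j / Λ`. -/
def mixedUniformDensity (k : ℕ) (lam : ℕ → ℝ≥0) (x : ℝ) : ℝ :=
  ∑ j ∈ Finset.Icc 1 k, (lam j : ℝ) / (totalRate k lam : ℝ) * uniformDensity 0 j x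

/-- The density of the mixed double uniform distribution: the mixture of the uniform
distributions on `[0, j]` and `[-j, 0]`, `1 ≤ j ≤ k`, with weights `lam j / (Λ + T)` and
`mu j / (Λ + T)`. -/
def mixedDoubleUniformDensity (k : ℕ) (lam mu : ℕ → ℝ≥0) (x : ℝ) : ℝ :=
  ∑ j ∈ Finset.Icc 1 k,
      (lam j : ℝ) / ((totalRate k lam : ℝ) + (totalRate k mu : ℝ)) * uniformDensity 0 j x
    + ∑ j ∈ Finset.Icc 1 k,
      (mu j : ℝ) / ((totalRate k lam : ℝ) + (totalRate k mu : ℝ)) * uniformDensity (-j) 0 x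

/-- The measure on `ℝ` with density `f` with respect to Lebesgue measure. -/
def lawOfDensity (f : ℝ → ℝ) : Measure ℝ := volume.withDensity (fun x => ENNReal.ofReal (f x))

/-- `N` and `X` are the ingredients of a compound Poisson process of rate `r` with jump law `ν`:
`N` is a Poisson process of rate `r`, and `X 0, X 1, …` are i.i.d. random variables with law `ν`,
independent of the process `N`. -/
structure IsCompoundPoissonData {Ω : Type*} [MeasurableSpace Ω] (r : ℝ≥0) (ν : Measure ℝ)
    (N : ℝ≥0 → Ω → ℕ) (X : ℕ → Ω → ℝ) (P : Measure Ω) : Prop where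
  poisson : IsPoissonProcess r N P
  measurable : ∀ i, Measurable (X i)
  law : ∀ i, P.map (X i) = ν
  iIndep : iIndepFun X P
  indep : IndepFun (fun ω t => N t ω) (fun ω i => X i ω) P

/-- The sum of the first `N t` of the variables `X 0, X 1, …`. -/
def compoundSum {Ω : Type*} (N : ℝ≥0 → Ω → ℕ) (X : ℕ → Ω → ℝ) (t : ℝ≥0) (ω : Ω) : ℝ :=
  ∑ i ∈ Finset.range (N t ω), X i ω

end

/-! The law of $M_A(t)$ is found without knowing the law of $M(t)$. Monotone paths make the right
Riemann sums with $n$ steps differ from the running average by at most $(M(t)-M(0))/n$, so they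
converge almost surely (`IsGCP.ae_tendsto_riemannAverage`), and their characteristic functions
converge too.

Abel summation writes a Riemann sum as a weighted sum of independent increments, each distributed as
$M(t/n)$, with weights $1/n,\dots,n/n$. Its characteristic function is therefore
$\prod_{l<n}\phi_{t/n}(u(l+1)/n)$, where $\phi_h$ is that of $M(h)$
(`IsGCP.charFun_riemannAverage`). The jump probabilities give $\phi_h(v)=1+h\psi(v)+o(h)$ uniformly
in $v$, with $\psi(v)=\sum_j\lambda_j(e^{ivj}-1)$ (`IsGCP.norm_charFun_sub_le`). Each factor may
thus be replaced by $e^{(t/n)\psi}$, and the exponents form a Riemann sum: the limit is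
$\exp(t\int_0^1\psi(ux)\,dx)$.

Since $\int_0^1e^{iujx}\,dx=(e^{iuj}-1)/(iuj)$ is also the characteristic function of the uniform
law on $[0,j]$, this limit is the transform of a compound Poisson sum with mixed uniform jumps. For
a GSP, independence multiplies the transforms of the two GCPs at $u$ and $-u$; the reflection
produces the uniform laws on $[-j,0]$. -/

/-! ### Riemann sums -/

/-- The right Riemann sum of a monotone function on `[0, t]` approximates its mean value. -/
lemma Monotone.abs_riemannSum_sub_average_le {f : ℝ → ℝ} (hf : Monotone f) {t : ℝ} (ht : 0 < t)
    {n : ℕ} (hn : 0 < n) :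
    |(∑ l ∈ Finset.range n, f (t * (l + 1 : ℕ) / n)) / n - 1 / t * ∫ s in (0 : ℝ)..t, f s|
      ≤ (f t - f 0) / n := by
  have hn' : (0 : ℝ) < n := by exact_mod_cast hn
  have hc : 0 < t / n := by positivity
  -- Rescaling by `t / n` moves the grid to the integers, where monotone sums and integrals compare.
  have hg : Monotone fun x => f (t / n * x) := fun x y hxy => hf (by gcongr)
  have lower := (hg.monotoneOn (Set.Icc (0 : ℝ) (0 + n))).sum_le_integral
  have upper := (hg.monotoneOn (Set.Icc (0 : ℝ) (0 + n))).integral_le_sum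
  rw [intervalIntegral.integral_comp_mul_left _ hc.ne'] at lower upper
  simp only [zero_add, mul_zero, div_mul_cancel₀ _ hn'.ne', smul_eq_mul] at lower upper
  -- The integral lies between the left and right sums, whose difference telescopes to `f t - f 0`.
  have tele := Finset.sum_range_sub (fun l : ℕ => f (t / n * l)) n
  simp only [Nat.cast_zero, mul_zero, div_mul_cancel₀ _ hn'.ne', Finset.sum_sub_distrib] at tele
  have hpt : ∀ l : ℕ, t * (l + 1 : ℕ) / n = t / n * (l + 1 : ℕ) := fun l => by ring
  simp only [hpt]
  set A := ∑ l ∈ Finset.range n, f (t / n * (l + 1 : ℕ))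
  set B := ∑ l ∈ Finset.range n, f (t / n * (l : ℕ))
  set J := ∫ s in (0 : ℝ)..t, f s
  have hJ : 1 / t * J = ((t / n)⁻¹ * J) / n := by field_simp
  rw [hJ, ← sub_div, abs_div, abs_of_pos hn']
  gcongr
  rw [abs_le]
  constructor <;> linarith

/-- The right Riemann sums of a Lipschitz function on `[0, 1]` converge to its integral. -/
lemma tendsto_riemannSum_of_lipschitz {g : ℝ → ℂ} {C : ℝ}
    (hg : ∀ x y, ‖g x - g y‖ ≤ C * |x - y|) (hcont : Continuous g) :
    Tendsto (fun n : ℕ => (∑ l ∈ Finset.range n, g ((l + 1 : ℕ) / n)) / n) atTop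
      (𝓝 (∫ x in (0 : ℝ)..1, g x)) := by
  have hC : 0 ≤ C := by simpa using (norm_nonneg _).trans (hg 1 0)
  rw [tendsto_iff_norm_sub_tendsto_zero]
  refine squeeze_zero' (.of_forall fun _ => norm_nonneg _) ?_
    (tendsto_const_div_atTop_nhds_zero_nat C)
  filter_upwards [eventually_gt_atTop 0] with n hn
  have hn' : (0 : ℝ) < n := by exact_mod_cast hn
  have hsplit := intervalIntegral.sum_integral_adjacent_intervals (μ := volume) (f := g)
    (a := fun l : ℕ => (l : ℝ) / n) (n := n) fun _ _ => hcont.intervalIntegrable _ _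
  simp only [Nat.cast_zero, zero_div, div_self hn'.ne'] at hsplit
  rw [← hsplit, Finset.sum_div, ← Finset.sum_sub_distrib]
  have hstep : ∀ l : ℕ, ((l + 1 : ℕ) : ℝ) / n - l / n = 1 / n := fun l => by
    push_cast; ring
  -- On a cell of length `1 / n`, `g` differs from its right endpoint value by at most `C / n`.
  have hterm : ∀ l ∈ Finset.range n,
      ‖g ((l + 1 : ℕ) / n) / n - ∫ x in ((l : ℝ) / n)..((l + 1 : ℕ) / n), g x‖
        ≤ C * (1 / n) * (1 / n) := by
    intro l _
    have hconst : g ((l + 1 : ℕ) / n) / n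
        = ∫ _ in ((l : ℝ) / n)..((l + 1 : ℕ) / n), g ((l + 1 : ℕ) / n) := by
      rw [intervalIntegral.integral_const, hstep, Complex.real_smul]
      push_cast; ring
    rw [hconst, ← intervalIntegral.integral_sub intervalIntegrable_const
      (hcont.intervalIntegrable _ _)]
    refine (intervalIntegral.norm_integral_le_of_norm_le_const (C := C * (1 / n)) ?_).trans_eq ?_
    · intro x hx
      have hle : (l : ℝ) / n ≤ (l + 1 : ℕ) / n := by gcongr; simp
      rw [Set.uIoc_of_le hle] at hx
      refine (hg _ _).trans ?_
      gcongr
      rw [abs_of_nonneg (by linarith [hx.2]), ← hstep l]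
      linarith [hx.1]
    · rw [hstep, abs_of_nonneg (by positivity)]
  refine (norm_sum_le_of_le _ hterm).trans_eq ?_
  simp
  field_simp

/-- Abel summation for the values of a sequence and its increments. -/
lemma sum_range_succ_values_eq_sum_increments (x : ℕ → ℝ) (n : ℕ) :
    ∑ l ∈ Finset.range n, x (l + 1)
      = ∑ l ∈ Finset.range n, ((n : ℝ) - l) * (x (l + 1) - x l) + n * x 0 := by
  induction n with
  | zero => simp
  | succ n ih =>
    have htele := Finset.sum_range_sub x n
    -- Passing from `n` to `n + 1` raises every weight by one, which adds a telescoping sum of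
    -- increments.
    have hadd : ∑ l ∈ Finset.range n, ((n + 1 : ℕ) - (l : ℝ)) * (x (l + 1) - x l)
        = ∑ l ∈ Finset.range n, ((n : ℝ) - l) * (x (l + 1) - x l) + (x n - x 0) := by
      rw [← htele, ← Finset.sum_add_distrib]
      exact Finset.sum_congr rfl fun l _ => by push_cast; ring
    rw [Finset.sum_range_succ, Finset.sum_range_succ, hadd, ih]
    push_cast
    ring

/-- Products of numbers in the closed unit disc differ by at most the sum of the differences. -/
lemma norm_prod_sub_prod_le_sum {ι : Type*} (s : Finset ι) {a b : ι → ℂ}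
    (ha : ∀ i, ‖a i‖ ≤ 1) (hb : ∀ i, ‖b i‖ ≤ 1) :
    ‖∏ i ∈ s, a i - ∏ i ∈ s, b i‖ ≤ ∑ i ∈ s, ‖a i - b i‖ := by
  classical
  induction s using Finset.induction_on with
  | empty => simp
  | insert i s hi ih =>
    rw [Finset.prod_insert hi, Finset.prod_insert hi, Finset.sum_insert hi]
    have hprod : ‖∏ i ∈ s, b i‖ ≤ 1 := by
      rw [norm_prod]
      exact Finset.prod_le_one (fun _ _ => norm_nonneg _) fun i _ => hb i
    calc ‖a i * ∏ j ∈ s, a j - b i * ∏ j ∈ s, b j‖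
        = ‖a i * (∏ j ∈ s, a j - ∏ j ∈ s, b j) + (a i - b i) * ∏ j ∈ s, b j‖ := by
          congr 1; ring
      _ ≤ ‖a i‖ * ‖∏ j ∈ s, a j - ∏ j ∈ s, b j‖ + ‖a i - b i‖ * ‖∏ j ∈ s, b j‖ := by
          exact (norm_add_le _ _).trans_eq (by simp only [norm_mul])
      _ ≤ 1 * ∑ j ∈ s, ‖a j - b j‖ + ‖a i - b i‖ * 1 := by
          gcongr
          exact ha i
      _ = _ := by ring

/-! ### Characteristic functions -/

lemma charFun_map_eq_integral {Ω : Type*} [MeasurableSpace Ω] {P : Measure Ω} {X : Ω → ℝ}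
    (hX : AEMeasurable X P) (u : ℝ) :
    charFun (P.map X) u = ∫ ω, Complex.exp (u * X ω * Complex.I) ∂P := by
  rw [charFun_apply_real, integral_map hX (by fun_prop)]

/-- Dominated convergence, the integrands having modulus one. Measurability of `Y` comes from the
limit itself. -/
lemma tendsto_charFun_of_ae_tendsto {Ω : Type*} [MeasurableSpace Ω] {P : Measure Ω}
    [IsFiniteMeasure P] {X : ℕ → Ω → ℝ} {Y : Ω → ℝ} (hX : ∀ n, AEMeasurable (X n) P)
    (hlim : ∀ᵐ ω ∂P, Tendsto (fun n => X n ω) atTop (𝓝 (Y ω))) (u : ℝ) :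
    Tendsto (fun n => charFun (P.map (X n)) u) atTop (𝓝 (charFun (P.map Y) u)) := by
  have hY : AEMeasurable Y P := aemeasurable_of_tendsto_metrizable_ae _ hX hlim
  simp only [charFun_map_eq_integral hY, charFun_map_eq_integral (hX _)]
  refine tendsto_integral_of_dominated_convergence (fun _ => 1) (fun n => ?_)
    (integrable_const _) (fun n => .of_forall fun ω => ?_) ?_
  · have := hX n
    fun_prop
  · rw [← Complex.ofReal_mul, Complex.norm_exp_ofReal_mul_I]
  · filter_upwards [hlim] with ω hω
    have hc : Continuous fun x : ℝ => Complex.exp (u * x * Complex.I) := by fun_prop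
    exact (hc.tendsto _).comp hω

/-! ### Running averages of counting processes -/

/-- The right Riemann sum, with `n` equal steps, of the running average of `X` at time `t`. -/
noncomputable def riemannAverage {Ω : Type*} (X : ℝ≥0 → Ω → ℝ) (t : ℝ≥0) (n : ℕ) (ω : Ω) : ℝ :=
  (∑ l ∈ Finset.range n, X (t * (l + 1 : ℕ) / n) ω) / n

/-- The characteristic exponent `∑ lam j * (exp (i v j) - 1)` of a GCP. -/
noncomputable def gcpExponent (k : ℕ) (lam : ℕ → ℝ≥0) (v : ℝ) : ℂ :=
  ∑ j ∈ Finset.Icc 1 k, (lam j : ℂ) * (Complex.exp (v * j * Complex.I) - 1)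

section Paths

variable {Ω : Type*} [MeasurableSpace Ω] {P : Measure Ω}

lemma IsCountingProcess.measurable_riemannAverage {M : ℝ≥0 → Ω → ℕ} (hM : IsCountingProcess M P)
    (t : ℝ≥0) (n : ℕ) : Measurable (riemannAverage (fun s ω => (M s ω : ℝ)) t n) := by
  have := hM.measurable
  unfold riemannAverage
  fun_prop

lemma IsCountingProcess.ae_monotone {M : ℝ≥0 → Ω → ℕ} (hM : IsCountingProcess M P) :
    ∀ᵐ ω ∂P, Monotone fun s : ℝ => (M s.toNNReal ω : ℝ) := by
  filter_upwards [hM.mono] with ω hω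
  exact fun a b hab => Nat.cast_le.2 (hω (Real.toNNReal_le_toNNReal hab))

lemma IsCountingProcess.ae_intervalIntegrable {M : ℝ≥0 → Ω → ℕ} (hM : IsCountingProcess M P)
    (a b : ℝ) : ∀ᵐ ω ∂P, IntervalIntegrable (fun s : ℝ => (M s.toNNReal ω : ℝ)) volume a b := by
  filter_upwards [hM.ae_monotone] with ω hω using hω.intervalIntegrable

/-- Monotonicity alone controls the error, so no right-continuity of the paths is needed. -/
lemma IsGCP.ae_tendsto_riemannAverage {k : ℕ} {lam : ℕ → ℝ≥0} {M : ℝ≥0 → Ω → ℕ}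
    (hM : IsGCP k lam M P) (t : ℝ≥0) :
    ∀ᵐ ω ∂P, Tendsto (fun n => riemannAverage (fun s ω => (M s ω : ℝ)) t n ω) atTop
      (𝓝 (runningAverage (fun s ω => (M s ω : ℝ)) t ω)) := by
  filter_upwards [hM.ae_monotone, hM.zero] with ω hω h0
  -- At `t = 0` both sides vanish: every sampled value is `M 0 = 0`, and the integral is over a
  -- degenerate interval.
  obtain rfl | ht := eq_zero_or_pos t
  · simp [riemannAverage, runningAverage, h0]
  have ht' : (0 : ℝ) < t := ht
  rw [tendsto_iff_norm_sub_tendsto_zero]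
  refine squeeze_zero' (.of_forall fun _ => norm_nonneg _) ?_
    (tendsto_const_div_atTop_nhds_zero_nat ((M t ω : ℝ) - M 0 ω))
  filter_upwards [eventually_gt_atTop 0] with n hn
  have hpt : ∀ l : ℕ, ((t : ℝ) * (l + 1 : ℕ) / n).toNNReal = t * (l + 1 : ℕ) / n := fun l => by
    rw [← Real.toNNReal_coe (r := t * (l + 1 : ℕ) / n)]
    push_cast
    rfl
  simpa only [riemannAverage, runningAverage, Real.toNNReal_coe, Real.toNNReal_zero, hpt,
    Real.norm_eq_abs] using hω.abs_riemannSum_sub_average_le ht' hn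

/-- The law of an increment of a GCP depends only on the length of the time step. -/
lemma IsGCP.map_increment {k : ℕ} {lam : ℕ → ℝ≥0} {M : ℝ≥0 → Ω → ℕ}
    (hM : IsGCP k lam M P) (s h : ℝ≥0) :
    P.map (fun ω => (M (s + h) ω : ℝ) - M s ω) = P.map (fun ω => (M h ω : ℝ)) := by
  rw [(hM.stationary_increments s h).map_eq]
  refine Measure.map_congr ?_
  filter_upwards [hM.zero] with ω h0
  simp [h0]

end Paths

/-! ### Increments of a GCP: product formula and first order expansion -/

section Increments

variable {Ω : Type*} [MeasurableSpace Ω] {P : Measure Ω}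
  {k : ℕ} {lam : ℕ → ℝ≥0} {M : ℝ≥0 → Ω → ℕ}

/-- An early increment is counted in all later sampled values: by Abel summation the increment over
step `l` has weight `(n - l) / n`. Independence gives the product and stationarity a common law. -/
lemma IsGCP.charFun_riemannAverage (hM : IsGCP k lam M P) (t : ℝ≥0) (n : ℕ) (u : ℝ) :
    charFun (P.map (riemannAverage (fun s ω => (M s ω : ℝ)) t n)) u
      = ∏ l ∈ Finset.range n,
          charFun (P.map fun ω => (M (t / n) ω : ℝ)) (u * ((l + 1 : ℕ) / n)) := by
  set τ : ℕ → ℝ≥0 := fun l => t * l / n with hτ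
  have hmono : Monotone τ := fun a b hab => by simp only [hτ]; gcongr
  have hstep : ∀ l, τ (l + 1) = τ l + t / n := fun l => by
    simp only [hτ]; push_cast; rw [mul_add, add_div, mul_one]
  have hmeas : ∀ l, Measurable fun ω => (M (τ (l + 1)) ω : ℝ) - M (τ l) ω := fun l => by
    have := hM.measurable
    fun_prop
  have hdecomp : riemannAverage (fun s ω => (M s ω : ℝ)) t n =ᵐ[P] fun ω =>
      ∑ l ∈ Finset.range n,
        (((n : ℝ) - l) / n) * ((M (τ (l + 1)) ω : ℝ) - M (τ l) ω) := by
    filter_upwards [hM.zero] with ω h0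
    have := sum_range_succ_values_eq_sum_increments (fun l => (M (τ l) ω : ℝ)) n
    have hτ0 : τ 0 = 0 := by simp [hτ]
    simp only [hτ0, h0, Nat.cast_zero, mul_zero, add_zero] at this
    rw [riemannAverage, this, Finset.sum_div]
    exact Finset.sum_congr rfl fun l _ => by ring
  have hindep : iIndepFun (fun (l : ℕ) ω =>
      (((n : ℝ) - l) / n) * ((M (τ (l + 1)) ω : ℝ) - M (τ l) ω)) P :=
    (hM.indep_increments.nat hmono).comp (fun l x => (((n : ℝ) - l) / n) * x)
      fun l => measurable_const_mul _
  -- The last rewrite reverses the order of the factors, turning the weights `(n - l) / n` into `(l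
  -- + 1) / n`.
  rw [Measure.map_congr hdecomp, (hindep.restrict _).charFun_map_fun_finsetSum_eq_prod
    fun l _ => ((hmeas l).const_mul _).aemeasurable, Finset.prod_apply,
    ← Finset.prod_range_reflect]
  refine Finset.prod_congr rfl fun l hl => ?_
  have hl' : l + 1 ≤ n := Finset.mem_range.1 hl
  rw [charFun_map_mul_comp (hmeas _).aemeasurable]
  simp only [hstep, hM.map_increment]
  congr 1
  rw [show n - 1 - l = n - (l + 1) by omega, Nat.cast_sub hl']
  push_cast
  ring

lemma norm_exp_mul_I_sub_one_le_two (x : ℝ) : ‖Complex.exp (x * Complex.I) - 1‖ ≤ 2 :=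
  (norm_sub_le _ _).trans (by rw [Complex.norm_exp_ofReal_mul_I, norm_one]; norm_num)

/-- First order expansion, uniform in `v`, of the characteristic function of a GCP at time `h`. -/
lemma IsGCP.norm_charFun_sub_le [IsProbabilityMeasure P] (hM : IsGCP k lam M P) (h : ℝ≥0)
    (v : ℝ) :
    ‖charFun (P.map fun ω => (M h ω : ℝ)) v - 1 - h * gcpExponent k lam v‖
      ≤ 2 * (∑ j ∈ Finset.Icc 1 k, |P.real {ω | M h ω = j} - (lam j : ℝ) * h|
          + P.real {ω | k < M h ω}) := by
  have hmeas := hM.measurable h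
  set e : ℕ → ℂ := fun j => Complex.exp (v * j * Complex.I) - 1 with he
  have he2 : ∀ j, ‖e j‖ ≤ 2 := fun j => by
    have := norm_exp_mul_I_sub_one_le_two (v * j)
    push_cast at this
    exact this
  have hsetj : ∀ j, MeasurableSet {ω | M h ω = j} := fun j => hmeas (measurableSet_singleton j)
  have hset : MeasurableSet {ω | k < M h ω} := measurableSet_lt measurable_const hmeas
  have hem : Measurable fun ω => e (M h ω) := (measurable_from_top (f := e)).comp hmeas
  have heint : Integrable (fun ω => e (M h ω)) P :=
    Integrable.of_bound hem.aestronglyMeasurable 2 (.of_forall fun ω => he2 _)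
  -- The value `0` needs no term because `e 0 = 0`; hence the probability of no jump never enters.
  have hsplit : ∀ ω, e (M h ω)
      = ∑ j ∈ Finset.Icc 1 k, {ω | M h ω = j}.indicator (fun _ => e j) ω
        + {ω | k < M h ω}.indicator (fun ω => e (M h ω)) ω := by
    intro ω
    simp only [Set.indicator_apply, Set.mem_ofPred_eq, Finset.sum_ite_eq, Finset.mem_Icc]
    rcases Nat.eq_zero_or_pos (M h ω) with h0 | h0
    · simp [h0, he]
    · by_cases hk : M h ω ≤ k
      · simp [hk, Nat.succ_le_of_lt h0]
      · simp [hk, not_le.1 hk]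
  have hchar : charFun (P.map fun ω => (M h ω : ℝ)) v - 1
      = ∑ j ∈ Finset.Icc 1 k, (P.real {ω | M h ω = j} : ℂ) * e j
        + ∫ ω in {ω | k < M h ω}, e (M h ω) ∂P := by
    have h1 : charFun (P.map fun ω => (M h ω : ℝ)) v - 1 = ∫ ω, e (M h ω) ∂P := by
      have hexp : Integrable (fun ω => Complex.exp (v * (M h ω : ℝ) * Complex.I)) P := by
        have := heint.add (integrable_const (1 : ℂ))
        refine this.congr (.of_forall fun ω => ?_)
        simp [he]
      rw [charFun_map_eq_integral (by fun_prop)]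
      simp only [he]
      have hsub := integral_sub hexp (integrable_const (1 : ℂ))
      simpa using hsub.symm
    rw [h1, integral_congr_ae (.of_forall hsplit), integral_add, integral_finsetSum]
    · congr 1
      · refine Finset.sum_congr rfl fun j _ => ?_
        rw [integral_indicator_const _ (hsetj j), Complex.real_smul]
      · rw [integral_indicator hset]
    · exact fun j _ => (integrable_const _).indicator (hsetj j)
    · exact integrable_finsetSum _ fun j _ => (integrable_const _).indicator (hsetj j)
    · exact heint.indicator hset
  have hrw : charFun (P.map fun ω => (M h ω : ℝ)) v - 1 - h * gcpExponent k lam v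
      = ∑ j ∈ Finset.Icc 1 k, ((P.real {ω | M h ω = j} - (lam j : ℝ) * h : ℝ) : ℂ) * e j
        + ∫ ω in {ω | k < M h ω}, e (M h ω) ∂P := by
    rw [hchar, gcpExponent, Finset.mul_sum, add_sub_right_comm, ← Finset.sum_sub_distrib]
    congr 1
    refine Finset.sum_congr rfl fun j _ => ?_
    simp only [he, Complex.ofReal_sub, Complex.ofReal_mul]
    ring
  rw [hrw, mul_add, Finset.mul_sum]
  refine (norm_add_le _ _).trans (add_le_add (norm_sum_le_of_le _ fun j _ => ?_) ?_)
  · rw [norm_mul, Complex.norm_real, Real.norm_eq_abs, mul_comm]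
    gcongr
    exact he2 j
  · exact norm_setIntegral_le_of_norm_le_const (measure_lt_top _ _) fun ω _ => he2 _

end Increments

/-! ### The characteristic function of the running average of a GCP -/

/-- This keeps the approximating exponentials in the closed unit disc, as
`norm_prod_sub_prod_le_sum` requires. -/
lemma gcpExponent_re_nonpos (k : ℕ) (lam : ℕ → ℝ≥0) (v : ℝ) : (gcpExponent k lam v).re ≤ 0 := by
  rw [gcpExponent, Complex.re_sum]
  refine Finset.sum_nonpos fun j _ => ?_
  have hre : (Complex.exp (v * j * Complex.I) - 1).re ≤ 0 := by
    have h := Complex.exp_ofReal_mul_I_re (v * j)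
    push_cast at h
    rw [Complex.sub_re, Complex.one_re, h]
    linarith [Real.cos_le_one (v * j)]
  have hmul : ((lam j : ℂ) * (Complex.exp (v * j * Complex.I) - 1)).re
      = lam j * (Complex.exp (v * j * Complex.I) - 1).re := Complex.re_ofReal_mul _ _
  rw [hmul]
  exact mul_nonpos_of_nonneg_of_nonpos (lam j).2 hre

lemma norm_gcpExponent_le (k : ℕ) (lam : ℕ → ℝ≥0) (v : ℝ) :
    ‖gcpExponent k lam v‖ ≤ 2 * totalRate k lam := by
  have hsum : (2 * totalRate k lam : ℝ) = ∑ j ∈ Finset.Icc 1 k, (lam j : ℝ) * 2 := by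
    rw [totalRate, NNReal.coe_sum, ← Finset.sum_mul, mul_comm]
  rw [hsum]
  refine norm_sum_le_of_le _ fun j _ => ?_
  have h2 := norm_exp_mul_I_sub_one_le_two (v * j)
  push_cast at h2
  rw [norm_mul, Complex.norm_real, NNReal.norm_eq]
  gcongr

lemma continuous_gcpExponent (k : ℕ) (lam : ℕ → ℝ≥0) : Continuous (gcpExponent k lam) := by
  unfold gcpExponent
  fun_prop

lemma norm_exp_mul_I_sub_le (x y : ℝ) :
    ‖Complex.exp (x * Complex.I) - Complex.exp (y * Complex.I)‖ ≤ |x - y| := by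
  have hfac : Complex.exp (x * Complex.I) - Complex.exp (y * Complex.I)
      = Complex.exp (y * Complex.I) * (Complex.exp (Complex.I * (x - y : ℝ)) - 1) := by
    rw [mul_sub, ← Complex.exp_add, mul_one]
    push_cast
    ring_nf
  rw [hfac, norm_mul, Complex.norm_exp_ofReal_mul_I, one_mul]
  exact Real.norm_exp_I_mul_ofReal_sub_one_le

/-- The Lipschitz bound under which Riemann sums of the exponent converge to its integral. -/
lemma norm_gcpExponent_sub_le (k : ℕ) (lam : ℕ → ℝ≥0) (v w : ℝ) :
    ‖gcpExponent k lam v - gcpExponent k lam w‖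
      ≤ (∑ j ∈ Finset.Icc 1 k, (lam j : ℝ) * j) * |v - w| := by
  rw [gcpExponent, gcpExponent, ← Finset.sum_sub_distrib, Finset.sum_mul]
  refine norm_sum_le_of_le _ fun j _ => ?_
  rw [← mul_sub, sub_sub_sub_cancel_right, norm_mul, Complex.norm_real, NNReal.norm_eq,
    mul_assoc (lam j : ℝ)]
  refine mul_le_mul_of_nonneg_left ?_ (lam j).2
  have h := norm_exp_mul_I_sub_le (v * j) (w * j)
  push_cast at h
  rwa [← sub_mul, abs_mul, Nat.abs_cast, mul_comm |v - w|] at h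

/-- The exponent of a GCP averaged over `[0, u]`. -/
lemma integral_gcpExponent (k : ℕ) (lam : ℕ → ℝ≥0) {u : ℝ} (hu : u ≠ 0) :
    ∫ x in (0 : ℝ)..1, gcpExponent k lam (u * x)
      = ∑ j ∈ Finset.Icc 1 k, (lam j : ℂ) *
          ((Complex.exp (Complex.I * u * j) - 1) / (Complex.I * u * j) - 1) := by
  unfold gcpExponent
  rw [intervalIntegral.integral_finsetSum fun j _ =>
    Continuous.intervalIntegrable (by fun_prop) _ _]
  refine Finset.sum_congr rfl fun j hj => ?_
  have hj0 : (j : ℂ) ≠ 0 := by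
    exact_mod_cast (Nat.one_le_iff_ne_zero.1 (Finset.mem_Icc.1 hj).1)
  have hc : Complex.I * u * j ≠ 0 :=
    mul_ne_zero (mul_ne_zero Complex.I_ne_zero (Complex.ofReal_ne_zero.2 hu)) hj0
  rw [intervalIntegral.integral_const_mul, intervalIntegral.integral_sub
    (Continuous.intervalIntegrable (by fun_prop) _ _) intervalIntegrable_const]
  have hcomm : ∀ x : ℝ, ((u * x : ℝ) : ℂ) * j * Complex.I = Complex.I * u * j * x := fun x => by
    push_cast; ring
  simp only [hcomm]
  rw [integral_exp_mul_complex hc]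
  simp

/-! ### Passage to the limit in the product formula -/

section Limit

variable {Ω : Type*} [MeasurableSpace Ω] {P : Measure Ω} [IsProbabilityMeasure P]
  {k : ℕ} {lam : ℕ → ℝ≥0} {M : ℝ≥0 → Ω → ℕ}

/-- Replacing one factor by its exponential costs at most `ε (t / n) + (t * B / n) ^ 2`, uniformly
in the frequency. Summed over `n` factors this still tends to `0`, because `ε h = o(h)`. -/
lemma IsGCP.tendsto_charFun_riemannAverage_of_pos (hM : IsGCP k lam M P) {t : ℝ≥0} (ht : 0 < t)
    (u : ℝ) :
    Tendsto (fun n => charFun (P.map (riemannAverage (fun s ω => (M s ω : ℝ)) t n)) u) atTop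
      (𝓝 (Complex.exp (t * ∫ x in (0 : ℝ)..1, gcpExponent k lam (u * x)))) := by
  have ht' : (0 : ℝ) < t := ht
  set g := gcpExponent k lam with hg
  set B : ℝ := 2 * totalRate k lam with hB
  set ε : ℝ≥0 → ℝ := fun h => 2 * (∑ j ∈ Finset.Icc 1 k,
    |P.real {ω | M h ω = j} - (lam j : ℝ) * h| + P.real {ω | k < M h ω}) with hε
  have hεo : ε =o[𝓝[>] (0 : ℝ≥0)] (fun h : ℝ≥0 => (h : ℝ)) := by
    refine IsLittleO.const_mul_left ?_ 2
    refine IsLittleO.add (IsLittleO.fun_sum fun j hj => ?_) hM.prob_large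
    exact (hM.prob_jump j hj).norm_left
  have hstep : Tendsto (fun n : ℕ => t / (n : ℝ≥0)) atTop (𝓝[>] 0) := by
    rw [tendsto_nhdsWithin_iff]
    constructor
    · rw [← NNReal.tendsto_coe]
      simpa using tendsto_const_div_atTop_nhds_zero_nat (t : ℝ)
    · filter_upwards [eventually_gt_atTop 0] with n hn
      have : (0 : ℝ≥0) < n := by exact_mod_cast hn
      exact Set.mem_Ioi.2 (by positivity)
  have hερ : Tendsto (fun n : ℕ => n * ε (t / n)) atTop (𝓝 0) := by
    -- With `h = t / n`, the quantity `n * ε h` equals `t * (ε h / h)`.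
    have h1 := (hεo.comp_tendsto hstep).tendsto_div_nhds_zero.const_mul (t : ℝ)
    rw [mul_zero] at h1
    refine h1.congr' ?_
    filter_upwards [eventually_gt_atTop 0] with n hn
    have hn' : (0 : ℝ) < n := by exact_mod_cast hn
    simp only [Function.comp_apply]
    push_cast
    field_simp
  -- the product of the exponentials of the first order terms
  have hexp : Tendsto (fun n : ℕ => ∏ l ∈ Finset.range n,
      Complex.exp ((t / n : ℂ) * g (u * ((l + 1 : ℕ) / n)))) atTop
      (𝓝 (Complex.exp (t * ∫ x in (0 : ℝ)..1, g (u * x)))) := by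
    have hR := tendsto_riemannSum_of_lipschitz (g := fun x => g (u * x))
      (C := (∑ j ∈ Finset.Icc 1 k, (lam j : ℝ) * j) * |u|) (fun x y => by
        rw [mul_assoc, ← abs_mul, mul_sub]
        exact norm_gcpExponent_sub_le k lam _ _)
      ((continuous_gcpExponent k lam).comp (by fun_prop))
    refine ((Complex.continuous_exp.tendsto _).comp (hR.const_mul (t : ℂ))).congr fun n => ?_
    rw [Function.comp_apply, ← Complex.exp_sum, ← Finset.mul_sum]
    congr 1
    ring
  have hdiff : Tendsto (fun n : ℕ =>
      charFun (P.map (riemannAverage (fun s ω => (M s ω : ℝ)) t n)) u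
        - ∏ l ∈ Finset.range n, Complex.exp ((t / n : ℂ) * g (u * ((l + 1 : ℕ) / n))))
      atTop (𝓝 0) := by
    have hbound : Tendsto (fun n : ℕ => n * ε (t / n) + (t * B) ^ 2 / n) atTop (𝓝 0) := by
      simpa using hερ.add (tendsto_const_div_atTop_nhds_zero_nat (((t : ℝ) * B) ^ 2))
    refine squeeze_zero_norm' ?_ hbound
    -- The quadratic bound on `exp z - 1 - z` is applied for `‖z‖ ≤ 1`.
    have hsmall : ∀ᶠ n : ℕ in atTop, (t * B) / n < 1 :=
      (tendsto_const_div_atTop_nhds_zero_nat ((t : ℝ) * B)).eventually_lt_const one_pos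
    filter_upwards [eventually_gt_atTop 0, hsmall] with n hn hn1
    have hn' : (0 : ℝ) < n := by exact_mod_cast hn
    rw [hM.charFun_riemannAverage]
    have hprob : IsProbabilityMeasure (P.map fun ω => (M (t / n) ω : ℝ)) := by
      have := hM.measurable (t / n)
      exact Measure.isProbabilityMeasure_map (by fun_prop)
    have hscal : (t / n : ℂ) = ((t / n : ℝ) : ℂ) := by push_cast; rfl
    refine (norm_prod_sub_prod_le_sum _ (fun l => norm_charFun_le_one _) fun l => ?_).trans ?_
    · rw [Complex.norm_exp, Real.exp_le_one_iff, hscal, Complex.re_ofReal_mul]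
      exact mul_nonpos_of_nonneg_of_nonpos (by positivity) (gcpExponent_re_nonpos k lam _)
    have hterm : ∀ l ∈ Finset.range n,
        ‖charFun (P.map fun ω => (M (t / n) ω : ℝ)) (u * ((l + 1 : ℕ) / n))
          - Complex.exp ((t / n : ℂ) * g (u * ((l + 1 : ℕ) / n)))‖
        ≤ ε (t / n) + ((t * B) / n) ^ 2 := by
      intro l _
      set v := u * ((l + 1 : ℕ) / n)
      have hz : ‖(t / n : ℂ) * g v‖ ≤ t * B / n := by
        rw [norm_mul, hscal, Complex.norm_real, Real.norm_of_nonneg (by positivity),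
          mul_div_right_comm]
        gcongr
        exact norm_gcpExponent_le k lam v
      have h1 := hM.norm_charFun_sub_le (t / n) v
      have h2 := Complex.norm_exp_sub_one_sub_id_le (hz.trans hn1.le)
      have hcast : (((t / n : ℝ≥0) : ℝ) : ℂ) = t / n := by push_cast; rfl
      rw [hcast] at h1
      -- Both factors are compared with `1 + z`, where `z = (t / n) * g v`.
      calc _ = ‖(charFun (P.map fun ω => (M (t / n) ω : ℝ)) v - 1 - (t / n : ℂ) * g v)
            - (Complex.exp ((t / n : ℂ) * g v) - 1 - (t / n : ℂ) * g v)‖ := by congr 1; ring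
        _ ≤ _ := norm_sub_le _ _
        _ ≤ _ := add_le_add h1 (h2.trans (by gcongr))
    refine (Finset.sum_le_sum hterm).trans_eq ?_
    rw [Finset.sum_const, Finset.card_range, nsmul_eq_mul]
    field_simp
  simpa using hdiff.add hexp

lemma IsGCP.tendsto_charFun_riemannAverage (hM : IsGCP k lam M P) (t : ℝ≥0) {u : ℝ} (hu : u ≠ 0) :
    Tendsto (fun n => charFun (P.map (riemannAverage (fun s ω => (M s ω : ℝ)) t n)) u) atTop
      (𝓝 (Complex.exp (t * ∑ j ∈ Finset.Icc 1 k, (lam j : ℂ) *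
          ((Complex.exp (Complex.I * u * j) - 1) / (Complex.I * u * j) - 1)))) := by
  rw [← integral_gcpExponent k lam hu]
  obtain rfl | ht := eq_zero_or_pos t
  · have hzero : ∀ n, riemannAverage (fun s ω => (M s ω : ℝ)) 0 n =ᵐ[P] fun _ => 0 := fun n => by
      filter_upwards [hM.zero] with ω h0
      simp [riemannAverage, h0]
    simp [Measure.map_congr (hzero _)]
  · exact hM.tendsto_charFun_riemannAverage_of_pos ht u

end Limit

/-! ### The running averages of a GCP and of a GSP -/

section RunningAverage

variable {Ω : Type*} [MeasurableSpace Ω] {P : Measure Ω}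
  {k : ℕ} {lam mu : ℕ → ℝ≥0}

lemma IsGCP.aemeasurable_runningAverage {M : ℝ≥0 → Ω → ℕ} (hM : IsGCP k lam M P) (t : ℝ≥0) :
    AEMeasurable (runningAverage (fun s ω => (M s ω : ℝ)) t) P :=
  aemeasurable_of_tendsto_metrizable_ae _
    (fun n => (hM.measurable_riemannAverage t n).aemeasurable) (hM.ae_tendsto_riemannAverage t)

lemma IsGCP.charFun_runningAverage [IsProbabilityMeasure P] {M : ℝ≥0 → Ω → ℕ}
    (hM : IsGCP k lam M P) (t : ℝ≥0) {u : ℝ} (hu : u ≠ 0) :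
    charFun (P.map (runningAverage (fun s ω => (M s ω : ℝ)) t)) u
      = Complex.exp (t * ∑ j ∈ Finset.Icc 1 k, (lam j : ℂ) *
          ((Complex.exp (Complex.I * u * j) - 1) / (Complex.I * u * j) - 1)) :=
  tendsto_nhds_unique
    (tendsto_charFun_of_ae_tendsto (fun n => (hM.measurable_riemannAverage t n).aemeasurable)
      (hM.ae_tendsto_riemannAverage t) u)
    (hM.tendsto_charFun_riemannAverage t hu)

lemma IsGSP.ae_intervalIntegrable {S : ℝ≥0 → Ω → ℤ} (hS : IsGSP k lam mu S P) (a b : ℝ) :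
    ∀ᵐ ω ∂P, IntervalIntegrable (fun s : ℝ => (S s.toNNReal ω : ℝ)) volume a b := by
  obtain ⟨M₁, M₂, h₁, h₂, -, hS⟩ := hS
  filter_upwards [h₁.ae_intervalIntegrable a b, h₂.ae_intervalIntegrable a b] with ω i₁ i₂
  simpa [hS] using i₁.sub i₂

lemma IsGCP.runningAverage_sub_ae_eq {M₁ M₂ : ℝ≥0 → Ω → ℕ} (h₁ : IsGCP k lam M₁ P)
    (h₂ : IsGCP k mu M₂ P) (t : ℝ≥0) :
    runningAverage (fun s ω => ((M₁ s ω - M₂ s ω : ℤ) : ℝ)) t =ᵐ[P] fun ω =>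
      runningAverage (fun s ω => (M₁ s ω : ℝ)) t ω
        - runningAverage (fun s ω => (M₂ s ω : ℝ)) t ω := by
  filter_upwards [h₁.ae_intervalIntegrable 0 t, h₂.ae_intervalIntegrable 0 t] with ω i₁ i₂
  simp only [runningAverage, Int.cast_sub, Int.cast_natCast]
  rw [intervalIntegral.integral_sub i₁ i₂, mul_sub]

lemma IsGSP.aemeasurable_runningAverage {S : ℝ≥0 → Ω → ℤ} (hS : IsGSP k lam mu S P) (t : ℝ≥0) :
    AEMeasurable (runningAverage (fun s ω => (S s ω : ℝ)) t) P := by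
  obtain ⟨M₁, M₂, h₁, h₂, -, hS⟩ := hS
  simp only [hS]
  exact ((h₁.aemeasurable_runningAverage t).sub (h₂.aemeasurable_runningAverage t)).congr
    (h₁.runningAverage_sub_ae_eq h₂ t).symm

/-- Independence is used for the Riemann averages, which are measurable functions of finitely many
coordinates of the paths, and only then is the limit taken. The independence of the two running
averages themselves is thus never needed. -/
lemma IsGSP.charFun_runningAverage [IsProbabilityMeasure P] {S : ℝ≥0 → Ω → ℤ}
    (hS : IsGSP k lam mu S P) (t : ℝ≥0) {u : ℝ} (hu : u ≠ 0) :
    charFun (P.map (runningAverage (fun s ω => (S s ω : ℝ)) t)) u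
      = Complex.exp (t * (∑ j ∈ Finset.Icc 1 k, (lam j : ℂ) *
            ((Complex.exp (Complex.I * u * j) - 1) / (Complex.I * u * j) - 1)
          + ∑ j ∈ Finset.Icc 1 k, (mu j : ℂ) *
            ((1 - Complex.exp (-(Complex.I * u * j))) / (Complex.I * u * j) - 1))) := by
  obtain ⟨M₁, M₂, h₁, h₂, hind, hS⟩ := hS
  simp only [hS]
  rw [Measure.map_congr (h₁.runningAverage_sub_ae_eq h₂ t)]
  set R₁ := riemannAverage (fun s ω => (M₁ s ω : ℝ)) t
  set R₂ := riemannAverage (fun s ω => (M₂ s ω : ℝ)) t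
  have m₁ : ∀ n, Measurable (R₁ n) := h₁.measurable_riemannAverage t
  have m₂ : ∀ n, Measurable (R₂ n) := h₂.measurable_riemannAverage t
  have hfun : ∀ n, Measurable fun p : ℝ≥0 → ℕ =>
      (∑ l ∈ Finset.range n, (p (t * (l + 1 : ℕ) / n) : ℝ)) / n := fun n => by fun_prop
  have hR : ∀ n, IndepFun (R₁ n) (fun ω => -1 * R₂ n ω) P := fun n =>
    hind.comp (hfun n) ((hfun n).const_mul (-1))
  have hchar : ∀ n, charFun (P.map fun ω => R₁ n ω - R₂ n ω) u
      = charFun (P.map (R₁ n)) u * charFun (P.map (R₂ n)) (-u) := by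
    intro n
    have h := congrFun ((hR n).charFun_map_fun_add_eq_mul (m₁ n).aemeasurable
      ((m₂ n).const_mul (-1)).aemeasurable) u
    rw [Pi.mul_apply, charFun_map_mul_comp (m₂ n).aemeasurable] at h
    simpa only [neg_one_mul, ← sub_eq_add_neg] using h
  have hlim₁ : ∀ᵐ ω ∂P, Tendsto (fun n => R₁ n ω - R₂ n ω) atTop
      (𝓝 (runningAverage (fun s ω => (M₁ s ω : ℝ)) t ω
        - runningAverage (fun s ω => (M₂ s ω : ℝ)) t ω)) := by
    filter_upwards [h₁.ae_tendsto_riemannAverage t, h₂.ae_tendsto_riemannAverage t] with ω a b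
    exact a.sub b
  have hlim₂ := (h₁.tendsto_charFun_riemannAverage t hu).mul
    (h₂.tendsto_charFun_riemannAverage t (neg_ne_zero.2 hu))
  refine (tendsto_nhds_unique ((tendsto_charFun_of_ae_tendsto
    (fun n => ((m₁ n).sub (m₂ n)).aemeasurable) hlim₁ u).congr hchar) hlim₂).trans ?_
  rw [← Complex.exp_add, ← mul_add]
  congr 3
  -- At `-u` the minus sign of the denominator moves into the numerator.
  refine Finset.sum_congr rfl fun j _ => ?_
  rw [Complex.ofReal_neg, mul_neg, neg_mul, div_neg, ← neg_div, neg_sub]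

end RunningAverage

/-! ### Compound Poisson sums -/

section CompoundPoisson

variable {Ω : Type*} [MeasurableSpace Ω] {P : Measure Ω}

/-- The number of terms ranges over a countable set, so it suffices to fix it. -/
lemma measurable_partialSum {ι : Type*} [MeasurableSpace ι] {X : ℕ → ι → ℝ}
    (hX : ∀ i, Measurable (X i)) :
    Measurable fun p : ℕ × ι => ∑ i ∈ Finset.range p.1, X i p.2 :=
  measurable_from_prod_countable_right fun n =>
    Finset.measurable_fun_sum (Finset.range n) fun i _ => hX i

lemma IsCompoundPoissonData.measurable_compoundSum {r : ℝ≥0} {ν : Measure ℝ} {N : ℝ≥0 → Ω → ℕ}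
    {X : ℕ → Ω → ℝ} (h : IsCompoundPoissonData r ν N X P) (t : ℝ≥0) :
    Measurable (compoundSum N X t) :=
  (measurable_partialSum h.measurable).comp ((h.poisson.measurable t).prodMk measurable_id)

/-- The generating function of the Poisson distribution. -/
lemma integral_pow_poissonMeasure (r : ℝ≥0) (z : ℂ) :
    ∫ n, z ^ n ∂(poissonMeasure r) = Complex.exp (r * (z - 1)) := by
  rw [integral_poissonMeasure]
  have hterm : ∀ n : ℕ, (Real.exp (-r) * r ^ n / n.factorial) • z ^ n
      = (Real.exp (-r) : ℂ) * ((r * z) ^ n / n.factorial) := fun n => by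
    rw [Complex.real_smul]
    push_cast
    rw [mul_pow]
    ring
  simp only [hterm]
  rw [tsum_mul_left, (NormedSpace.expSeries_div_hasSum_exp ((r : ℂ) * z)).tsum_eq,
    ← Complex.exp_eq_exp_ℂ, Complex.ofReal_exp, ← Complex.exp_add]
  push_cast
  ring_nf

/-- By independence the count can be integrated last: `n` jumps contribute `charFun ν u ^ n`, and
the Poisson generating function sums these powers. -/
lemma IsCompoundPoissonData.charFun_compoundSum [IsProbabilityMeasure P] {r : ℝ≥0} {ν : Measure ℝ}
    {N : ℝ≥0 → Ω → ℕ} {X : ℕ → Ω → ℝ} (h : IsCompoundPoissonData r ν N X P) (t : ℝ≥0) (u : ℝ) :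
    charFun (P.map (compoundSum N X t)) u
      = Complex.exp ((r * t : ℝ≥0) * (charFun ν u - 1)) := by
  have mN := h.poisson.measurable t
  have mX : Measurable fun ω i => X i ω := measurable_pi_iff.2 h.measurable
  have hind : IndepFun (N t) (fun ω i => X i ω) P :=
    h.indep.comp (measurable_pi_apply t) measurable_id
  have hlaw := (indepFun_iff_map_prod_eq_prod_map_map mN.aemeasurable mX.aemeasurable).1 hind
  rw [h.poisson.law t] at hlaw
  set μ := P.map fun ω i => X i ω with hμ
  have : IsProbabilityMeasure μ := Measure.isProbabilityMeasure_map mX.aemeasurable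
  have hsum : Measurable fun p : ℕ × (ℕ → ℝ) => ∑ i ∈ Finset.range p.1, p.2 i :=
    measurable_partialSum (X := fun i (x : ℕ → ℝ) => x i) measurable_pi_apply
  have hF : Measurable fun p : ℕ × (ℕ → ℝ) =>
      Complex.exp (u * (∑ i ∈ Finset.range p.1, p.2 i : ℝ) * Complex.I) := by fun_prop
  have hint : Integrable (fun p : ℕ × (ℕ → ℝ) =>
      Complex.exp (u * (∑ i ∈ Finset.range p.1, p.2 i : ℝ) * Complex.I))
      ((poissonMeasure (r * t)).prod μ) :=
    Integrable.of_bound hF.aestronglyMeasurable 1 (.of_forall fun p => by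
      rw [← Complex.ofReal_mul, Complex.norm_exp_ofReal_mul_I])
  have hinner : ∀ n : ℕ, ∫ x, Complex.exp (u * (∑ i ∈ Finset.range n, x i : ℝ) * Complex.I) ∂μ
      = charFun ν u ^ n := by
    intro n
    rw [hμ, integral_map mX.aemeasurable (by fun_prop), ← charFun_map_eq_integral
      (X := fun ω => ∑ i ∈ Finset.range n, X i ω)
      (Finset.measurable_fun_sum _ fun i _ => h.measurable i).aemeasurable,
      (h.iIndep.restrict _).charFun_map_fun_finsetSum_eq_prod
        fun i _ => (h.measurable i).aemeasurable, Finset.prod_apply]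
    simp [h.law]
  calc charFun (P.map (compoundSum N X t)) u
      = ∫ ω, Complex.exp (u * (∑ i ∈ Finset.range (N t ω), X i ω : ℝ) * Complex.I) ∂P :=
        charFun_map_eq_integral (h.measurable_compoundSum t).aemeasurable u
    _ = ∫ p, Complex.exp (u * (∑ i ∈ Finset.range p.1, p.2 i : ℝ) * Complex.I)
          ∂((poissonMeasure (r * t)).prod μ) := by
        rw [← hlaw, integral_map (mN.prodMk mX).aemeasurable hF.aestronglyMeasurable]
    _ = ∫ n, charFun ν u ^ n ∂(poissonMeasure (r * t)) := by
        rw [integral_prod _ hint]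
        simp only [hinner]
    _ = _ := integral_pow_poissonMeasure _ _

/-- Two random variables have the same law once their characteristic
functions agree away from `0`. -/
lemma map_eq_of_charFun_eq_of_ne_zero {Ω' : Type*} [MeasurableSpace Ω'] {P' : Measure Ω'}
    [IsProbabilityMeasure P] [IsProbabilityMeasure P'] {X : Ω → ℝ} {Y : Ω' → ℝ}
    (hX : AEMeasurable X P) (hY : AEMeasurable Y P')
    (h : ∀ u, u ≠ 0 → charFun (P.map X) u = charFun (P'.map Y) u) : P.map X = P'.map Y := by
  have := Measure.isProbabilityMeasure_map hX
  have := Measure.isProbabilityMeasure_map hY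
  refine Measure.ext_of_charFun (funext fun u => ?_)
  obtain rfl | hu := eq_or_ne u 0
  · simp
  · exact h u hu

end CompoundPoisson

/-! ### Mixtures of uniform distributions -/

section Density

lemma uniformDensity_nonneg {a b : ℝ} (hab : a ≤ b) (x : ℝ) : 0 ≤ uniformDensity a b x :=
  Set.indicator_nonneg (fun _ _ => one_div_nonneg.2 (sub_nonneg.2 hab)) x

lemma measurable_uniformDensity (a b : ℝ) : Measurable (uniformDensity a b) :=
  measurable_const.indicator measurableSet_Icc

lemma charFun_lawOfDensity {f : ℝ → ℝ} (hf : Measurable f) (h0 : ∀ x, 0 ≤ f x) (u : ℝ) :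
    charFun (lawOfDensity f) u = ∫ x, (f x : ℂ) * Complex.exp (u * x * Complex.I) := by
  rw [charFun_apply_real, lawOfDensity, integral_withDensity_eq_integral_toReal_smul
    hf.ennreal_ofReal (.of_forall fun x => ENNReal.ofReal_lt_top)]
  refine integral_congr_ae (.of_forall fun x => ?_)
  simp only [ENNReal.toReal_ofReal (h0 x), Complex.real_smul]

lemma uniformDensity_mul_eq_indicator (a b : ℝ) (g : ℝ → ℂ) (x : ℝ) :
    (uniformDensity a b x : ℂ) * g x
      = (Set.Icc a b).indicator (fun x => (1 / (b - a) : ℂ) * g x) x := by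
  by_cases hx : x ∈ Set.Icc a b <;> simp [uniformDensity, hx]

lemma integrable_uniformDensity_mul (a b u : ℝ) :
    Integrable fun x : ℝ => (uniformDensity a b x : ℂ) * Complex.exp (u * x * Complex.I) := by
  simp only [uniformDensity_mul_eq_indicator a b fun x : ℝ => Complex.exp (u * x * Complex.I)]
  rw [integrable_indicator_iff measurableSet_Icc]
  exact Continuous.integrableOn_Icc (by fun_prop)

/-- The characteristic function of the uniform distribution on `[a, b]`. -/
lemma integral_uniformDensity_mul {a b : ℝ} (hab : a ≤ b) {u : ℝ} (hu : u ≠ 0) :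
    ∫ x : ℝ, (uniformDensity a b x : ℂ) * Complex.exp (u * x * Complex.I)
      = (Complex.exp (Complex.I * u * b) - Complex.exp (Complex.I * u * a))
          / (Complex.I * u * (b - a)) := by
  simp only [uniformDensity_mul_eq_indicator a b fun x : ℝ => Complex.exp (u * x * Complex.I)]
  rw [integral_indicator measurableSet_Icc, integral_Icc_eq_integral_Ioc,
    ← intervalIntegral.integral_of_le hab, intervalIntegral.integral_const_mul]
  have hc : Complex.I * u ≠ 0 := mul_ne_zero Complex.I_ne_zero (Complex.ofReal_ne_zero.2 hu)
  have hcomm : ∀ x : ℝ, (u : ℂ) * x * Complex.I = Complex.I * u * x := fun x => by ring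
  simp only [hcomm]
  rw [integral_exp_mul_complex hc, one_div, mul_comm, ← div_eq_mul_inv, div_div]

variable {k : ℕ} {lam mu : ℕ → ℝ≥0}

lemma integral_uniformDensity_zero_left_mul (j : ℕ) {u : ℝ} (hu : u ≠ 0) :
    ∫ x : ℝ, (uniformDensity 0 j x : ℂ) * Complex.exp (u * x * Complex.I)
      = (Complex.exp (Complex.I * u * j) - 1) / (Complex.I * u * j) := by
  rw [integral_uniformDensity_mul (Nat.cast_nonneg j) hu]
  simp

lemma integral_uniformDensity_zero_right_mul (j : ℕ) {u : ℝ} (hu : u ≠ 0) :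
    ∫ x : ℝ, (uniformDensity (-j) 0 x : ℂ) * Complex.exp (u * x * Complex.I)
      = (1 - Complex.exp (-(Complex.I * u * j))) / (Complex.I * u * j) := by
  rw [integral_uniformDensity_mul (neg_nonpos.2 (Nat.cast_nonneg j)) hu]
  simp

lemma charFun_mixedDoubleUniform {u : ℝ} (hu : u ≠ 0) :
    charFun (lawOfDensity (mixedDoubleUniformDensity k lam mu)) u
      = ∑ j ∈ Finset.Icc 1 k, (lam j / (totalRate k lam + totalRate k mu) : ℂ) *
            ((Complex.exp (Complex.I * u * j) - 1) / (Complex.I * u * j))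
        + ∑ j ∈ Finset.Icc 1 k, (mu j / (totalRate k lam + totalRate k mu) : ℂ) *
            ((1 - Complex.exp (-(Complex.I * u * j))) / (Complex.I * u * j)) := by
  have hmeas : Measurable (mixedDoubleUniformDensity k lam mu) :=
    (Finset.measurable_fun_sum _ fun j _ => (measurable_uniformDensity _ _).const_mul _).add
      (Finset.measurable_fun_sum _ fun j _ => (measurable_uniformDensity _ _).const_mul _)
  have hnonneg : ∀ x, 0 ≤ mixedDoubleUniformDensity k lam mu x := fun x =>
    add_nonneg
      (Finset.sum_nonneg fun j _ => mul_nonneg (by positivity)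
        (uniformDensity_nonneg (Nat.cast_nonneg j) x))
      (Finset.sum_nonneg fun j _ => mul_nonneg (by positivity)
        (uniformDensity_nonneg (neg_nonpos.2 (Nat.cast_nonneg j)) x))
  rw [charFun_lawOfDensity hmeas hnonneg]
  simp only [mixedDoubleUniformDensity, Complex.ofReal_add, Complex.ofReal_sum, Complex.ofReal_mul,
    Complex.ofReal_div, add_mul, Finset.sum_mul, mul_assoc]
  have hint : ∀ (c : ℂ) (a b : ℝ), Integrable fun x : ℝ =>
      c * ((uniformDensity a b x : ℂ) * Complex.exp (u * (x * Complex.I))) := fun c a b => by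
    simpa only [mul_assoc] using (integrable_uniformDensity_mul a b u).const_mul c
  rw [integral_add (integrable_finsetSum _ fun j _ => hint _ _ _)
    (integrable_finsetSum _ fun j _ => hint _ _ _),
    integral_finsetSum _ fun j _ => hint _ _ _, integral_finsetSum _ fun j _ => hint _ _ _]
  congr 1 <;> refine Finset.sum_congr rfl fun j _ => ?_
  · rw [integral_const_mul]
    simp only [← mul_assoc]
    rw [integral_uniformDensity_zero_left_mul j hu]
  · rw [integral_const_mul]
    simp only [← mul_assoc]
    rw [integral_uniformDensity_zero_right_mul j hu]

/-- Lets the GCP case reuse the double uniform computation with `mu = 0`. -/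
lemma mixedUniformDensity_eq_double (k : ℕ) (lam : ℕ → ℝ≥0) :
    mixedUniformDensity k lam = mixedDoubleUniformDensity k lam 0 := by
  funext x
  simp [mixedUniformDensity, mixedDoubleUniformDensity, totalRate]

/-- The exponent of the compound Poisson sum with mixed double uniform jumps. -/
lemma rate_mul_charFun_mixedDoubleUniform_sub_one
    (hpos : 0 < totalRate k lam + totalRate k mu) (t : ℝ≥0) {u : ℝ} (hu : u ≠ 0) :
    (((totalRate k lam + totalRate k mu) * t : ℝ≥0) : ℂ) *
        (charFun (lawOfDensity (mixedDoubleUniformDensity k lam mu)) u - 1)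
      = t * (∑ j ∈ Finset.Icc 1 k, (lam j : ℂ) *
            ((Complex.exp (Complex.I * u * j) - 1) / (Complex.I * u * j) - 1)
          + ∑ j ∈ Finset.Icc 1 k, (mu j : ℂ) *
            ((1 - Complex.exp (-(Complex.I * u * j))) / (Complex.I * u * j) - 1)) := by
  rw [charFun_mixedDoubleUniform hu]
  have hr : ((totalRate k lam : ℝ) + (totalRate k mu : ℝ) : ℂ) ≠ 0 := by
    have : (0 : ℝ) < totalRate k lam + totalRate k mu := by exact_mod_cast hpos
    exact_mod_cast this.ne'
  have hcoe : ∀ l : ℕ → ℝ≥0, ((totalRate k l : ℝ) : ℂ) = ∑ j ∈ Finset.Icc 1 k, ((l j : ℝ) : ℂ) :=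
    fun l => by rw [totalRate]; push_cast; rfl
  have hcancel : ∀ (l : ℕ → ℝ≥0) (z : ℕ → ℂ),
      ((totalRate k lam : ℝ) + (totalRate k mu : ℝ) : ℂ) *
        ∑ j ∈ Finset.Icc 1 k, ((l j : ℝ) / ((totalRate k lam : ℝ) + (totalRate k mu : ℝ)) : ℂ) * z j
      = ∑ j ∈ Finset.Icc 1 k, ((l j : ℝ) : ℂ) * z j := fun l z => by
    rw [Finset.mul_sum]
    exact Finset.sum_congr rfl fun j _ => by field_simp
  push_cast
  rw [mul_comm _ (((t : ℝ) : ℂ)), mul_assoc, mul_sub, mul_add, hcancel, hcancel, mul_one]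
  -- The `- 1` in each summand adds up to the total rates, matching the single `- 1` on the compound
  -- Poisson side.
  simp only [mul_sub, mul_one, Finset.sum_sub_distrib, ← hcoe]
  ring

end Density

/-! ### Laws of the running averages -/

theorem mainTheorem12 {Ω Ω' : Type*} [MeasurableSpace Ω] [MeasurableSpace Ω']
    (P : Measure Ω) [IsProbabilityMeasure P] (P' : Measure Ω') [IsProbabilityMeasure P']
    (k : ℕ) (lam mu : ℕ → ℝ≥0) :
    -- the running average of a GSP
    (∀ S : ℝ≥0 → Ω → ℤ, IsGSP k lam mu S P → ∀ t : ℝ≥0,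
      (∀ᵐ ω ∂P, IntervalIntegrable (fun s : ℝ => (S s.toNNReal ω : ℝ)) volume 0 t) ∧
      AEMeasurable (runningAverage (fun s ω => (S s ω : ℝ)) t) P ∧
      charFun (P.map (runningAverage (fun s ω => (S s ω : ℝ)) t)) 0 = 1 ∧
      (∀ u : ℝ, u ≠ 0 →
        charFun (P.map (runningAverage (fun s ω => (S s ω : ℝ)) t)) u =
          Complex.exp ((t : ℂ) *
            (∑ j ∈ Finset.Icc 1 k, (lam j : ℂ) *
                ((Complex.exp (Complex.I * u * j) - 1) / (Complex.I * u * j) - 1)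
              + ∑ j ∈ Finset.Icc 1 k, (mu j : ℂ) *
                ((1 - Complex.exp (-(Complex.I * u * j))) / (Complex.I * u * j) - 1)))) ∧
      (0 < totalRate k lam + totalRate k mu →
        ∀ (N : ℝ≥0 → Ω' → ℕ) (X : ℕ → Ω' → ℝ),
          IsCompoundPoissonData (totalRate k lam + totalRate k mu)
            (lawOfDensity (mixedDoubleUniformDensity k lam mu)) N X P' →
          IdentDistrib (compoundSum N X t)
            (runningAverage (fun s ω => (S s ω : ℝ)) t) P' P)) ∧
    -- the running average of a GCP
    (∀ M : ℝ≥0 → Ω → ℕ, IsGCP k lam M P → ∀ t : ℝ≥0,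
      (∀ᵐ ω ∂P, IntervalIntegrable (fun s : ℝ => (M s.toNNReal ω : ℝ)) volume 0 t) ∧
      AEMeasurable (runningAverage (fun s ω => (M s ω : ℝ)) t) P ∧
      charFun (P.map (runningAverage (fun s ω => (M s ω : ℝ)) t)) 0 = 1 ∧
      (∀ u : ℝ, u ≠ 0 →
        charFun (P.map (runningAverage (fun s ω => (M s ω : ℝ)) t)) u =
          Complex.exp ((t : ℂ) *
            ∑ j ∈ Finset.Icc 1 k, (lam j : ℂ) *
              ((Complex.exp (Complex.I * u * j) - 1) / (Complex.I * u * j) - 1))) ∧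
      (0 < totalRate k lam →
        ∀ (N : ℝ≥0 → Ω' → ℕ) (X : ℕ → Ω' → ℝ),
          IsCompoundPoissonData (totalRate k lam)
            (lawOfDensity (mixedUniformDensity k lam)) N X P' →
          IdentDistrib (runningAverage (fun s ω => (M s ω : ℝ)) t)
            (compoundSum N X t) P P')) := by
  refine ⟨fun S hS t => ?_, fun M hM t => ?_⟩
  · have hmeas := hS.aemeasurable_runningAverage t
    have := Measure.isProbabilityMeasure_map hmeas
    refine ⟨hS.ae_intervalIntegrable 0 t, hmeas, by simp,
      fun u hu => hS.charFun_runningAverage t hu, fun hpos N X hX => ?_⟩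
    have hsum := (hX.measurable_compoundSum t).aemeasurable (μ := P')
    refine ⟨hsum, hmeas, map_eq_of_charFun_eq_of_ne_zero hsum hmeas fun u hu => ?_⟩
    rw [hX.charFun_compoundSum, hS.charFun_runningAverage t hu,
      rate_mul_charFun_mixedDoubleUniform_sub_one hpos t hu]
  · have hmeas := hM.aemeasurable_runningAverage t
    have := Measure.isProbabilityMeasure_map hmeas
    refine ⟨hM.ae_intervalIntegrable 0 t, hmeas, by simp,
      fun u hu => hM.charFun_runningAverage t hu, fun hpos N X hX => ?_⟩
    have hsum := (hX.measurable_compoundSum t).aemeasurable (μ := P')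
    refine ⟨hmeas, hsum, map_eq_of_charFun_eq_of_ne_zero hmeas hsum fun u hu => ?_⟩
    have hzero : totalRate k 0 = 0 := by simp [totalRate]
    have hexp := rate_mul_charFun_mixedDoubleUniform_sub_one (k := k) (lam := lam) (mu := 0)
      (by simpa [hzero] using hpos) t hu
    rw [hzero, add_zero, ← mixedUniformDensity_eq_double] at hexp
    rw [hX.charFun_compoundSum, hM.charFun_runningAverage t hu, hexp]
    simp
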